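/- Let $n\ge 3$, let $\epsilon\in\{1,-1\}$, and let $\mathbb{E}^{n+2}$ denote $\mathbb{R}^{n+2}$ with the flat metric $\epsilon\,dx_1^2+dx_2^2+\dots+dx_{n+2}^2$, i.e. Euclidean space if $\epsilon=1$ and Lorentzian space if $\epsilon=-1$. Let $M$ be a smooth $n$-dimensional Riemannian manifold of constant sectional curvature $c\neq 0$, and let $g\colon M\to\mathbb{E}^{n+2}$ be an isometric immersion, i.e. a smooth map whose differential carries the Riemannian metric of $M$ to the metric of $\mathbb{E}^{n+2}$. Then $g$ has flat normal bundle: the curvature tensor $$R^\perp(X,Y)\xi=\nabla^\perp_X\nabla^\perp_Y\xi-\nabla^\perp_Y\nabla^\perp_X\xi-\nabla^\perp_{[X,Y]}\xi$$ of its normal connection $\nabla^\perp$ vanishes identically, for all smooth tangent vector fields $X,Y$ and all smooth normal vector fields $\xi$. Here $\nabla^\perp_X\xi$ is the component normal to $g$ of the derivative of $\xi$ along $X$ in $\mathbb{E}^{n+2}$. -/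

import Mathlib

open Bundle
open scoped Manifold ContDiff

noncomputable section

namespace FlatNormalBundle

section Intrinsic

variable {n : ℕ} {M : Type*} [TopologicalSpace M] [ChartedSpace (EuclideanSpace ℝ (Fin n)) M]
  [IsManifold (𝓡 n) ∞ M]
  [RiemannianBundle (fun x : M ↦ TangentSpace (𝓡 n) x)]
  [IsContMDiffRiemannianBundle (𝓡 n) ∞ (EuclideanSpace ℝ (Fin n))
    (fun x : M ↦ TangentSpace (𝓡 n) x)]

/-- The vector field `X` is smooth near `x`. -/
def SmoothFieldAt (X : Π x : M, TangentSpace (𝓡 n) x) (x : M) : Prop :=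
  ContMDiffAt (𝓡 n) (𝓡 n).tangent ∞ (fun p ↦ (⟨p, X p⟩ : TangentBundle (𝓡 n) M)) x

/-- A connection `∇` on the tangent bundle of a Riemannian manifold is the Levi-Civita connection
if it is torsion-free and compatible with the metric. -/
def IsLeviCivita (cov : CovariantDerivative (𝓡 n) (EuclideanSpace ℝ (Fin n))
    (fun x : M ↦ TangentSpace (𝓡 n) x)) : Prop :=
  haveI : IsContMDiffRiemannianBundle (𝓡 n) 1 (EuclideanSpace ℝ (Fin n))
      (fun x : M ↦ TangentSpace (𝓡 n) x) :=
    IsContMDiffRiemannianBundle.of_le (n := ∞) (by norm_cast)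
  cov.torsion = 0 ∧ cov.IsMetricCompatible

/-- The curvature `R(X, Y) Z = ∇_X ∇_Y Z - ∇_Y ∇_X Z - ∇_[X, Y] Z` of a connection on the tangent
bundle. In Mathlib's argument order, `∇_X Z` at `p` is `cov Z p (X p)`. -/
def curvature (cov : CovariantDerivative (𝓡 n) (EuclideanSpace ℝ (Fin n))
      (fun x : M ↦ TangentSpace (𝓡 n) x))
    (X Y Z : Π x : M, TangentSpace (𝓡 n) x) (x : M) : TangentSpace (𝓡 n) x :=
  cov (fun p ↦ cov Z p (Y p)) x (X x) - cov (fun p ↦ cov Z p (X p)) x (Y x)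
    - cov Z x (VectorField.mlieBracket (𝓡 n) X Y x)

/-- The sectional curvature
`K(X, Y) = ⟨R(X, Y) Y, X⟩ / (⟨X, X⟩ ⟨Y, Y⟩ - ⟨X, Y⟩ ^ 2)` at `x` of the plane spanned by `X x` and
`Y x`; meaningful when these two vectors are linearly independent. -/
def sectionalCurvature (cov : CovariantDerivative (𝓡 n) (EuclideanSpace ℝ (Fin n))
      (fun x : M ↦ TangentSpace (𝓡 n) x))
    (X Y : Π x : M, TangentSpace (𝓡 n) x) (x : M) : ℝ :=
  inner ℝ (curvature cov X Y Y x) (X x) /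
    (inner ℝ (X x) (X x) * inner ℝ (Y x) (Y x) - inner ℝ (X x) (Y x) ^ 2)

variable (n M) in
/-- The Riemannian manifold `M` has constant sectional curvature `c`: for its (unique) Levi-Civita
connection, the sectional curvature of every tangent plane is `c`. Tangent planes are given by pairs
of vector fields which are smooth near the point. -/
def HasConstantSectionalCurvature (c : ℝ) : Prop :=
  ∃ cov : CovariantDerivative (𝓡 n) (EuclideanSpace ℝ (Fin n))
      (fun x : M ↦ TangentSpace (𝓡 n) x),
    IsLeviCivita cov ∧
      ∀ (x : M) (X Y : Π x : M, TangentSpace (𝓡 n) x),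
        SmoothFieldAt X x → SmoothFieldAt Y x →
        LinearIndependent ℝ ![X x, Y x] → sectionalCurvature cov X Y x = c

end Intrinsic

section Extrinsic

/-- The flat metric `ε dx₁² + dx₂² + ⋯ + dx_{n+2}²` on `ℝ^{n+2}`: Euclidean for `ε = 1`, Lorentzian
for `ε = -1`. The indices run from `0`. -/
def ambientForm {n : ℕ} (ε : ℝ) (v w : EuclideanSpace ℝ (Fin (n + 2))) : ℝ :=
  ε * (v 0 * w 0) + ∑ i : Fin (n + 1), v i.succ * w i.succ

lemma ambientForm_add_left {n : ℕ} (ε : ℝ) (v v' w : EuclideanSpace ℝ (Fin (n + 2))) :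
    ambientForm ε (v + v') w = ambientForm ε v w + ambientForm ε v' w := by
  simp [ambientForm, add_mul, Finset.sum_add_distrib]
  ring

lemma ambientForm_smul_left {n : ℕ} (ε a : ℝ) (v w : EuclideanSpace ℝ (Fin (n + 2))) :
    ambientForm ε (a • v) w = a * ambientForm ε v w := by
  simp [ambientForm, mul_assoc, mul_add, Finset.mul_sum]
  ring

variable {n : ℕ} {M : Type*} [TopologicalSpace M] [ChartedSpace (EuclideanSpace ℝ (Fin n)) M]

/-- The differential of a map `f : M → ℝ^{n+2}` at `x`, with values in `ℝ^{n+2}`. -/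
abbrev differential (f : M → EuclideanSpace ℝ (Fin (n + 2))) (x : M) :
    TangentSpace (𝓡 n) x →L[ℝ] EuclideanSpace ℝ (Fin (n + 2)) :=
  mvfderiv (𝓡 n) f x

/-- The normal space of `g : M → 𝔼^{n+2}` at `x`: the orthogonal complement, for the ambient metric,
of the image of the differential. -/
def normalSpace (ε : ℝ) (g : M → EuclideanSpace ℝ (Fin (n + 2))) (x : M) :
    Submodule ℝ (EuclideanSpace ℝ (Fin (n + 2))) where
  carrier := {v | ∀ u : TangentSpace (𝓡 n) x, ambientForm ε v (differential g x u) = 0}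
  add_mem' {a b} ha hb u := by rw [ambientForm_add_left, ha u, hb u, add_zero]
  zero_mem' u := by simp [ambientForm]
  smul_mem' a v hv u := by rw [ambientForm_smul_left, hv u, mul_zero]

variable [RiemannianBundle (fun x : M ↦ TangentSpace (𝓡 n) x)]

/-- `g : M → 𝔼^{n+2}` is an isometric immersion: it is smooth and its differential carries the
Riemannian metric of `M` to the ambient metric. -/
structure IsIsometricImmersion (ε : ℝ) (g : M → EuclideanSpace ℝ (Fin (n + 2))) : Prop where
  contMDiff : ContMDiff (𝓡 n) 𝓘(ℝ, EuclideanSpace ℝ (Fin (n + 2))) ∞ g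
  isometric : ∀ (x : M) (u v : TangentSpace (𝓡 n) x),
    ambientForm ε (differential g x u) (differential g x v) = inner ℝ u v

instance (x : M) : FiniteDimensional ℝ (TangentSpace (𝓡 n) x) :=
  inferInstanceAs (FiniteDimensional ℝ (EuclideanSpace ℝ (Fin n)))

/-- The component of `v` normal to the isometric immersion `g` at `x`: subtract from `v` its
tangential component `∑ᵢ ⟨v, dg eᵢ⟩ dg eᵢ`, with `(eᵢ)` an orthonormal basis of `T_x M`. -/
def normalPart (ε : ℝ) (g : M → EuclideanSpace ℝ (Fin (n + 2))) (x : M)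
    (v : EuclideanSpace ℝ (Fin (n + 2))) : EuclideanSpace ℝ (Fin (n + 2)) :=
  v - ∑ i, ambientForm ε v (differential g x (stdOrthonormalBasis ℝ (TangentSpace (𝓡 n) x) i)) •
    differential g x (stdOrthonormalBasis ℝ (TangentSpace (𝓡 n) x) i)

/-- The normal part differs from the vector by a tangent vector. -/
lemma sub_normalPart_mem_range (ε : ℝ) (g : M → EuclideanSpace ℝ (Fin (n + 2))) (x : M)
    (v : EuclideanSpace ℝ (Fin (n + 2))) :
    v - normalPart ε g x v ∈ (differential g x).range := by
  rw [normalPart, sub_sub_cancel]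
  exact Submodule.sum_mem _ fun i _ ↦ Submodule.smul_mem _ _ ⟨_, rfl⟩

/-- The normal part is normal. -/
lemma normalPart_mem_normalSpace {ε : ℝ} {g : M → EuclideanSpace ℝ (Fin (n + 2))}
    (hg : IsIsometricImmersion ε g) (x : M) (v : EuclideanSpace ℝ (Fin (n + 2))) :
    normalPart ε g x v ∈ normalSpace ε g x := by
  intro u
  have key : ∀ w, ambientForm ε w (differential g x u) =
      ({ toFun := fun w ↦ ambientForm ε w (differential g x u)
         map_add' := fun a b ↦ ambientForm_add_left ε a b _
         map_smul' := fun a b ↦ ambientForm_smul_left ε a b _ } :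
        EuclideanSpace ℝ (Fin (n + 2)) →ₗ[ℝ] ℝ) w := fun _ ↦ rfl
  have comm : ∀ a b : EuclideanSpace ℝ (Fin (n + 2)), ambientForm ε a b = ambientForm ε b a := by
    intro a b; simp [ambientForm, mul_comm]
  set b := stdOrthonormalBasis ℝ (TangentSpace (𝓡 n) x) with hb
  have hu : ambientForm ε v (differential g x u) =
      ∑ i, inner ℝ (b i) u * ambientForm ε v (differential g x (b i)) := by
    have key' : ∀ w, ambientForm ε v w =
        ({ toFun := fun w ↦ ambientForm ε w v
           map_add' := fun a b ↦ ambientForm_add_left ε a b _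
           map_smul' := fun a b ↦ ambientForm_smul_left ε a b _ } :
          EuclideanSpace ℝ (Fin (n + 2)) →ₗ[ℝ] ℝ) w := fun w ↦ comm _ _
    conv_lhs => rw [← b.sum_repr' u, key', map_sum, map_sum]
    refine Finset.sum_congr rfl fun i _ ↦ ?_
    rw [map_smul, map_smul, ← key']
    rfl
  rw [key, normalPart, map_sub, map_sum, ← key, hu, sub_eq_zero]
  refine Finset.sum_congr rfl fun i _ ↦ ?_
  rw [map_smul, ← key, hg.isometric, smul_eq_mul, mul_comm]

/-- The normal connection `∇^⊥_X ξ`: the normal component of the derivative of `ξ` along `X`. Normal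
fields of `g` are regarded as `ℝ^{n+2}`-valued functions on `M`. -/
def normalConnection (ε : ℝ) (g : M → EuclideanSpace ℝ (Fin (n + 2)))
    (X : Π x : M, TangentSpace (𝓡 n) x) (ξ : M → EuclideanSpace ℝ (Fin (n + 2))) (x : M) :
    EuclideanSpace ℝ (Fin (n + 2)) :=
  normalPart ε g x (differential ξ x (X x))

/-- The normal curvature
`R^⊥(X, Y) ξ = ∇^⊥_X ∇^⊥_Y ξ - ∇^⊥_Y ∇^⊥_X ξ - ∇^⊥_[X, Y] ξ`. -/
def normalCurvature (ε : ℝ) (g : M → EuclideanSpace ℝ (Fin (n + 2)))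
    (X Y : Π x : M, TangentSpace (𝓡 n) x) (ξ : M → EuclideanSpace ℝ (Fin (n + 2))) (x : M) :
    EuclideanSpace ℝ (Fin (n + 2)) :=
  normalConnection ε g X (normalConnection ε g Y ξ) x
    - normalConnection ε g Y (normalConnection ε g X ξ) x
    - normalConnection ε g (VectorField.mlieBracket (𝓡 n) X Y) ξ x

/-- `g` has flat normal bundle: the normal curvature vanishes at every point, for all tangent
vector fields `X`, `Y` and normal fields `ξ` smooth near the point. -/
def HasFlatNormalBundle [IsManifold (𝓡 n) ∞ M] (ε : ℝ)
    (g : M → EuclideanSpace ℝ (Fin (n + 2))) : Prop :=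
  ∀ (x : M) (X Y : Π x : M, TangentSpace (𝓡 n) x) (ξ : M → EuclideanSpace ℝ (Fin (n + 2))),
    SmoothFieldAt X x → SmoothFieldAt Y x →
    ContMDiffAt (𝓡 n) 𝓘(ℝ, EuclideanSpace ℝ (Fin (n + 2))) ∞ ξ x →
    (∀ p, ξ p ∈ normalSpace ε g p) →
    normalCurvature ε g X Y ξ x = 0

end Extrinsic

end FlatNormalBundle

end

/-! The image of `dg` is positive definite, so for either sign of `ε` the normal space is a
nondegenerate plane and has an orthogonal basis `η₁, η₂` of non-isotropic vectors. Let `A, B` be the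
corresponding shape operators, `p = 1/⟨η₁,η₁⟩` and `q = 1/⟨η₂,η₂⟩`. The Gauss equation becomes `p A
∧ A + q B ∧ B = c I ∧ I`, while the Ricci equation expresses `R^⊥` through the commutator of `A` and
`B`. It remains to see that `A` and `B` commute, which is pure algebra (`commute_of_gauss`,
`sum_smul_comm_of_gauss`).

Diagonalize `A` with eigenvalues `aᵢ` and let `bᵢⱼ` be the entries of `B`. Commutation means that
`bᵢⱼ ≠ 0` forces `aᵢ = aⱼ`. Since `n ≥ 3` there is a third index `k`. The mixed components of the
Gauss equation do not involve the diagonal `A`, so the mixed minors of `B` on `i, j, k` vanish; with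
`bᵢⱼ ≠ 0` this kills the principal minors on `{i,k}` and `{j,k}`. The Gauss equation on these two
planes then reads `p aᵢ aₖ = c = p aⱼ aₖ`, and `c ≠ 0` allows cancelling `p aₖ`.

The geometric input is `gauss_equation` and `ricci_equation`. Both rest on `mvfderiv_mlieBracket`,
the commutation rule for derivatives of vector-valued functions, and the former also on
`inner_leviCivita`, which identifies the Levi-Civita connection with the tangential part of the
ambient derivative. -/

namespace FlatNormalBundle

/-! ### Commuting symmetric operators from the Gauss equation -/

section Algebra

variable {V : Type*} [NormedAddCommGroup V] [InnerProductSpace ℝ V]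

/-- Polarization of the Gauss equation, known on planes, in one pair of arguments. -/
lemma gauss_polarize {A B : V →ₗ[ℝ] V} (hA : A.IsSymmetric) (hB : B.IsSymmetric) {p q c : ℝ}
    (h : ∀ x y : V, p * (inner ℝ (A x) x * inner ℝ (A y) y - inner ℝ (A x) y ^ 2)
      + q * (inner ℝ (B x) x * inner ℝ (B y) y - inner ℝ (B x) y ^ 2)
      = c * (inner ℝ x x * inner ℝ y y - inner ℝ x y ^ 2)) (x z y : V) :
    p * (inner ℝ (A x) z * inner ℝ (A y) y - inner ℝ (A x) y * inner ℝ (A z) y)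
      + q * (inner ℝ (B x) z * inner ℝ (B y) y - inner ℝ (B x) y * inner ℝ (B z) y)
      = c * (inner ℝ x z * inner ℝ y y - inner ℝ x y * inner ℝ z y) := by
  have h1 := h (x + z) y
  have h2 := h x y
  have h3 := h z y
  have sA : inner ℝ (A z) x = inner ℝ (A x) z := by rw [hA z x, real_inner_comm]
  have sB : inner ℝ (B z) x = inner ℝ (B x) z := by rw [hB z x, real_inner_comm]
  have s : inner ℝ z x = inner ℝ x z := real_inner_comm _ _
  simp only [map_add, inner_add_left, inner_add_right, sA, sB, s] at h1
  linear_combination (h1 - h2 - h3) / 2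

/-- Two symmetric operators `A`, `B` in dimension at least three with
`p A ∧ A + q B ∧ B = c I ∧ I`, where `c ≠ 0`, commute. -/
theorem commute_of_gauss [FiniteDimensional ℝ V] (hn : 3 ≤ Module.finrank ℝ V)
    {A B : V →ₗ[ℝ] V} (hA : A.IsSymmetric) (hB : B.IsSymmetric) {p q c : ℝ}
    (hq : q ≠ 0) (hc : c ≠ 0)
    (h : ∀ x y : V, p * (inner ℝ (A x) x * inner ℝ (A y) y - inner ℝ (A x) y ^ 2)
      + q * (inner ℝ (B x) x * inner ℝ (B y) y - inner ℝ (B x) y ^ 2)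
      = c * (inner ℝ x x * inner ℝ y y - inner ℝ x y ^ 2)) (x y : V) :
    inner ℝ (A x) (B y) = inner ℝ (A y) (B x) := by
  have hpol := gauss_polarize hA hB h
  set e := hA.eigenvectorBasis rfl with he
  set a := hA.eigenvalues rfl with ha
  have hAe : ∀ i, A (e i) = a i • e i := fun i ↦ by simp [he, ha]
  have horth : ∀ i j, i ≠ j → inner ℝ (e i) (e j) = 0 := fun i j hij ↦ e.orthonormal.2 hij
  have hnorm : ∀ i, inner ℝ (e i) (e i) = (1 : ℝ) := fun i ↦ by simp
  have sB : ∀ i j, inner ℝ (B (e i)) (e j) = inner ℝ (B (e j)) (e i) := fun i j ↦ by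
    rw [hB, real_inner_comm]
  -- An off-diagonal entry of `B` can only join equal eigenvalues of `A`.
  have key : ∀ i j, i ≠ j → inner ℝ (B (e i)) (e j) ≠ 0 → a i = a j := by
    intro i j hij hb
    obtain ⟨k, hki, hkj⟩ : ∃ k, k ≠ i ∧ k ≠ j := by
      have : 2 < Fintype.card (Fin (Module.finrank ℝ V)) := by
        simpa [Nat.lt_iff_add_one_le] using hn
      obtain ⟨k, hk⟩ : ∃ k, k ∉ ({i, j} : Finset (Fin (Module.finrank ℝ V))) := by
        by_contra! hall
        have := (Finset.eq_univ_of_forall hall) ▸ Finset.card_le_two (a := i) (b := j)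
        simp at this
        omega
      exact ⟨k, by simpa [not_or] using hk⟩
    -- Mixed components on the triple `i, j, k`: every `A` term and the right-hand side vanish,
    -- leaving minors of `B`.
    have e1 := hpol (e j) (e k) (e i)
    have e2 := hpol (e i) (e k) (e j)
    have e3 := hpol (e i) (e j) (e k)
    have d1 := h (e i) (e k)
    have d2 := h (e j) (e k)
    simp only [hAe, inner_smul_left, horth i j hij, horth j i hij.symm, horth i k hki.symm,
      horth k i hki, horth j k hkj.symm, horth k j hkj, hnorm, sB k i, sB k j, sB j i,
      RCLike.conj_to_real] at e1 e2 e3 d1 d2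
    set bij := inner ℝ (B (e i)) (e j)
    set bik := inner ℝ (B (e i)) (e k)
    set bjk := inner ℝ (B (e j)) (e k)
    set bii := inner ℝ (B (e i)) (e i)
    set bjj := inner ℝ (B (e j)) (e j)
    set bkk := inner ℝ (B (e k)) (e k)
    have m1 : bjk * bii - bij * bik = 0 := by
      have : q * (bjk * bii - bij * bik) = 0 := by linear_combination e1
      exact (mul_eq_zero.1 this).resolve_left hq
    have m2 : bik * bjj - bij * bjk = 0 := by
      have : q * (bik * bjj - bij * bjk) = 0 := by linear_combination e2
      exact (mul_eq_zero.1 this).resolve_left hq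
    have m3 : bij * bkk - bik * bjk = 0 := by
      have : q * (bij * bkk - bik * bjk) = 0 := by linear_combination e3
      exact (mul_eq_zero.1 this).resolve_left hq
    -- A combination of mixed minors equals `bij` times a principal minor, and `bij ≠ 0`.
    have n1 : bjj * bkk - bjk ^ 2 = 0 := by
      have : bij * (bjj * bkk - bjk ^ 2) = 0 := by linear_combination bjj * m3 + bjk * m2
      exact (mul_eq_zero.1 this).resolve_left hb
    have n2 : bii * bkk - bik ^ 2 = 0 := by
      have : bij * (bii * bkk - bik ^ 2) = 0 := by linear_combination bii * m3 + bik * m1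
      exact (mul_eq_zero.1 this).resolve_left hb
    have c1 : p * (a i * a k) = c := by linear_combination d1 - q * n2
    have c2 : p * (a j * a k) = c := by linear_combination d2 - q * n1
    have hak : p * a k ≠ 0 := by
      rintro h0
      apply hc
      linear_combination -c1 + a i * h0
    apply mul_right_cancel₀ hak
    linear_combination c1 - c2
  have main : ∀ i j, inner ℝ (A (e i)) (B (e j)) = inner ℝ (A (e j)) (B (e i)) := by
    intro i j
    simp only [hAe, inner_smul_left, RCLike.conj_to_real]
    rw [← hB (e i) (e j), ← hB (e j) (e i), sB j i]
    by_cases hij : i = j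
    · rw [hij]
    · by_cases hb : inner ℝ (B (e i)) (e j) = 0
      · rw [hb]; simp
      · rw [key i j hij hb]
  have : ((innerₗ V).compl₁₂ A B) = ((innerₗ V).compl₁₂ A B).flip := by
    refine LinearMap.BilinForm.ext_basis e.toBasis fun i j ↦ ?_
    simpa using main i j
  simpa using congr($this x y)

end Algebra

open Filter Topology VectorField

/-! ### Derivatives of vector-valued functions along vector fields -/

section Calculus

variable {n : ℕ} {M : Type*} [TopologicalSpace M] [ChartedSpace (EuclideanSpace ℝ (Fin n)) M]
  {F : Type*} [NormedAddCommGroup F] [NormedSpace ℝ F]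
  {F₁ : Type*} [NormedAddCommGroup F₁] [NormedSpace ℝ F₁]
  {F₂ : Type*} [NormedAddCommGroup F₂] [NormedSpace ℝ F₂]

lemma mvfderiv_congr {f h : M → F} {x : M} (hfh : f =ᶠ[𝓝 x] h) :
    mvfderiv (𝓡 n) f x = mvfderiv (𝓡 n) h x := by
  ext v
  simp only [mvfderiv]
  rw [hfh.mfderiv_eq]
  rfl

/-- The product rule for a continuous bilinear map. -/
lemma mvfderiv_bilinear (B : F₁ →L[ℝ] F₂ →L[ℝ] F) {f : M → F₁} {h : M → F₂} {x : M}
    (hf : MDifferentiableAt (𝓡 n) 𝓘(ℝ, F₁) f x) (hh : MDifferentiableAt (𝓡 n) 𝓘(ℝ, F₂) h x)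
    (v : TangentSpace (𝓡 n) x) :
    mvfderiv (𝓡 n) (fun p ↦ B (f p) (h p)) x v =
      B (mvfderiv (𝓡 n) f x v) (h x) + B (f x) (mvfderiv (𝓡 n) h x v) := by
  obtain ⟨f', hf'⟩ : ∃ f' : EuclideanSpace ℝ (Fin n) →L[ℝ] F₁,
    HasMFDerivAt (𝓡 n) 𝓘(ℝ, F₁) f x f' := ⟨_, hf.hasMFDerivAt⟩
  obtain ⟨h', hh'⟩ : ∃ h' : EuclideanSpace ℝ (Fin n) →L[ℝ] F₂,
    HasMFDerivAt (𝓡 n) 𝓘(ℝ, F₂) h x h' := ⟨_, hh.hasMFDerivAt⟩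
  have key : HasMFDerivAt (𝓡 n) 𝓘(ℝ, F) (fun p ↦ B (f p) (h p)) x
      (B.precompR _ (f x) h' + B.precompL _ f' (h x) : EuclideanSpace ℝ (Fin n) →L[ℝ] F) := by
    refine ⟨?_, ?_⟩
    · exact (B.continuous.continuousAt.comp hf'.1).clm_apply hh'.1
    · have := B.hasFDerivWithinAt_of_bilinear hf'.2 hh'.2
      simpa only [writtenInExtChartAt, extChartAt_model_space_eq_id, PartialEquiv.refl_coe,
        Function.id_comp, Function.comp_apply, extChartAt_to_inv, Function.comp_def, id] using! this
  simp only [mvfderiv, key.mfderiv, hf'.mfderiv, hh'.mfderiv]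
  exact add_comm _ _

variable [IsManifold (𝓡 n) ∞ M]

/-- The derivative of a smooth function along a smooth vector field is smooth. -/
lemma contMDiffAt_mvfderiv_apply {f : M → F} {Y : Π p : M, TangentSpace (𝓡 n) p} {x : M}
    (hf : ContMDiffAt (𝓡 n) 𝓘(ℝ, F) ∞ f x) (hY : SmoothFieldAt Y x) :
    ContMDiffAt (𝓡 n) 𝓘(ℝ, F) ∞ (fun p ↦ mvfderiv (𝓡 n) f p (Y p)) x := by
  have h1 := ContMDiffAt.mfderiv_const (m := ∞) hf (by simp)
  have h2 := ContMDiffAt.clm_apply_of_inCoordinates (b₁ := id) (v := Y) h1 hY hf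
  exact (contMDiff_snd_tangentBundle_modelSpace F 𝓘(ℝ, F)).contMDiffAt.comp x h2

/-- Derivation along `[X, Y]` is the commutator of the derivations along `X` and `Y`. -/
lemma mvfderiv_mlieBracket {f : M → F} {X Y : Π p : M, TangentSpace (𝓡 n) p} {x : M}
    (hf : ContMDiffAt (𝓡 n) 𝓘(ℝ, F) ∞ f x) (hX : SmoothFieldAt X x) (hY : SmoothFieldAt Y x) :
    mvfderiv (𝓡 n) f x (mlieBracket (𝓡 n) X Y x) =
      mvfderiv (𝓡 n) (fun p ↦ mvfderiv (𝓡 n) f p (Y p)) x (X x)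
        - mvfderiv (𝓡 n) (fun p ↦ mvfderiv (𝓡 n) f p (X p)) x (Y x) := by
  -- The identity is pulled back by the inverse chart `ψ` to an open subset of `ℝⁿ`, where it
  -- follows from the symmetry of the second derivative.
  set φ := extChartAt (𝓡 n) x with hφ
  set ψ := φ.symm with hψ
  set y₀ := φ x with hy₀
  have hψy : ψ y₀ = x := extChartAt_to_inv x
  have htarget : ∀ᶠ y in 𝓝 y₀, y ∈ φ.target := extChartAt_target_mem_nhds x
  have hy₀t : y₀ ∈ φ.target := mem_extChartAt_target x
  have hinv : ∀ y ∈ φ.target, (mfderiv 𝓘(ℝ, EuclideanSpace ℝ (Fin n)) (𝓡 n) ψ y).IsInvertible := by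
    intro y hy
    have := isInvertible_mfderivWithin_extChartAt_symm (I := 𝓡 n) hy
    rwa [(𝓡 n).range_eq_univ, mfderivWithin_univ] at this
  have hψs : ContMDiffAt 𝓘(ℝ, EuclideanSpace ℝ (Fin n)) (𝓡 n) ∞ ψ y₀ :=
    (contMDiffOn_extChartAt_symm x).contMDiffAt (extChartAt_target_mem_nhds x)
  have hfd : ∀ {h : M → F} {y}, y ∈ φ.target → MDifferentiableAt (𝓡 n) 𝓘(ℝ, F) h (ψ y) →
      ∀ Z : Π p : M, TangentSpace (𝓡 n) p, mvfderiv (𝓡 n) h (ψ y) (Z (ψ y)) =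
        fderiv ℝ (h ∘ ψ) y (mpullback 𝓘(ℝ, EuclideanSpace ℝ (Fin n)) (𝓡 n) ψ Z y) := by
    intro h y hy hh Z
    have hψd : MDifferentiableAt 𝓘(ℝ, EuclideanSpace ℝ (Fin n)) (𝓡 n) ψ y :=
      mdifferentiableAt_of_isInvertible_mfderiv (hinv y hy)
    rw [← mfderiv_eq_fderiv, mfderiv_comp y hh hψd]
    have e : mfderiv 𝓘(ℝ, EuclideanSpace ℝ (Fin n)) (𝓡 n) ψ y
        (mpullback 𝓘(ℝ, EuclideanSpace ℝ (Fin n)) (𝓡 n) ψ Z y) = Z (ψ y) :=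
      (hinv y hy).self_apply_inverse _
    rw [← e]
    rfl
  have hd : ∀ {Z : Π p : M, TangentSpace (𝓡 n) p}, SmoothFieldAt Z x →
      DifferentiableAt ℝ (mpullback 𝓘(ℝ, EuclideanSpace ℝ (Fin n)) (𝓡 n) ψ Z) y₀ := by
    intro Z hZ
    refine MDifferentiableAt.differentiableAt ?_
    have h1 : MDifferentiableAt 𝓘(ℝ, EuclideanSpace ℝ (Fin n))
        𝓘(ℝ, EuclideanSpace ℝ (Fin n)).tangent (fun y ↦
        (⟨y, mpullback 𝓘(ℝ, EuclideanSpace ℝ (Fin n)) (𝓡 n) ψ Z y⟩ :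
          TangentBundle 𝓘(ℝ, EuclideanSpace ℝ (Fin n)) (EuclideanSpace ℝ (Fin n)))) y₀ := by
      refine MDifferentiableAt.mpullback_vectorField (n := ∞) ?_ hψs (hinv y₀ hy₀t) (by norm_cast)
      rw [hψy]
      exact ContMDiffAt.mdifferentiableAt hZ (by simp)
    exact ((contMDiff_snd_tangentBundle_modelSpace _ _).contMDiffAt.mdifferentiableAt
      one_ne_zero).comp y₀ h1
  have hfψ : ContDiffAt ℝ ∞ (f ∘ ψ) y₀ := by
    rw [← contMDiffAt_iff_contDiffAt]
    refine ContMDiffAt.comp y₀ ?_ hψs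
    rwa [hψy]
  -- Needed on a whole neighbourhood, since this function is differentiated once more.
  have hev : ∀ Z : Π p : M, TangentSpace (𝓡 n) p,
      (fun p ↦ mvfderiv (𝓡 n) f p (Z p)) ∘ ψ =ᶠ[𝓝 y₀] fun y ↦
        fderiv ℝ (f ∘ ψ) y (mpullback 𝓘(ℝ, EuclideanSpace ℝ (Fin n)) (𝓡 n) ψ Z y) := by
    intro Z
    have h2 : ∀ᶠ p in 𝓝 (ψ y₀), ContMDiffAt (𝓡 n) 𝓘(ℝ, F) 1 f p := by
      rw [hψy]
      exact (contMDiffAt_iff_contMDiffAt_nhds (by simp)).1 (hf.of_le (by norm_cast))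
    filter_upwards [htarget, hψs.continuousAt.eventually h2] with y hy hy2
    exact hfd hy (hy2.mdifferentiableAt one_ne_zero) Z
  have hfin : ∀ {h : M → F}, MDifferentiableAt (𝓡 n) 𝓘(ℝ, F) h x →
      ∀ Z : Π p : M, TangentSpace (𝓡 n) p, mvfderiv (𝓡 n) h x (Z x) =
        fderiv ℝ (h ∘ ψ) y₀ (mpullback 𝓘(ℝ, EuclideanSpace ℝ (Fin n)) (𝓡 n) ψ Z y₀) := by
    intro h hh Z
    have := hfd hy₀t (h := h) (by rwa [hψy]) Z
    rwa [hψy] at this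
  have hmin : minSmoothness ℝ 2 ≤ (∞ : WithTop ℕ∞) := by
    rw [minSmoothness_of_isRCLikeNormedField]
    norm_cast
  have : IsManifold (𝓡 n) (minSmoothness ℝ 2) M := .of_le (n := ∞) hmin
  have hbr : mpullback 𝓘(ℝ, EuclideanSpace ℝ (Fin n)) (𝓡 n) ψ (mlieBracket (𝓡 n) X Y) y₀ =
      lieBracket ℝ (mpullback 𝓘(ℝ, EuclideanSpace ℝ (Fin n)) (𝓡 n) ψ X)
        (mpullback 𝓘(ℝ, EuclideanSpace ℝ (Fin n)) (𝓡 n) ψ Y) y₀ := by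
    rw [mpullback_mlieBracket (n := ∞) _ _ hψs hmin]
    · rw [← mlieBracketWithin_univ, mlieBracketWithin_eq_lieBracketWithin]
      exact congrFun lieBracketWithin_univ y₀
    · rw [hψy]
      exact ContMDiffAt.mdifferentiableAt hX (by simp)
    · rw [hψy]
      exact ContMDiffAt.mdifferentiableAt hY (by simp)
  have key := fderiv_apply_lieBracket hfψ hmin (hd hY) (hd hX)
  rw [hfin (hf.mdifferentiableAt (by simp)), hbr,
    hfin ((contMDiffAt_mvfderiv_apply hf hY).mdifferentiableAt (by simp)),
    hfin ((contMDiffAt_mvfderiv_apply hf hX).mdifferentiableAt (by simp)),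
    (hev X).fderiv_eq, (hev Y).fderiv_eq]
  exact key

end Calculus

/-! ### The ambient metric as a bilinear map -/

section Ambient

variable {n : ℕ}

/-- The ambient metric as a continuous bilinear map. -/
noncomputable def ambientCLM (n : ℕ) (ε : ℝ) :
    EuclideanSpace ℝ (Fin (n + 2)) →L[ℝ] EuclideanSpace ℝ (Fin (n + 2)) →L[ℝ] ℝ :=
  LinearMap.toContinuousBilinearMap <| LinearMap.mk₂ ℝ (ambientForm ε)
    (fun v v' w ↦ ambientForm_add_left ε v v' w) (fun a v w ↦ ambientForm_smul_left ε a v w)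
    (fun v w w' ↦ by simp [ambientForm, mul_add, Finset.sum_add_distrib]; ring)
    (fun a v w ↦ by simp [ambientForm, mul_add, Finset.mul_sum, mul_left_comm])

lemma ambientCLM_apply (ε : ℝ) (v w : EuclideanSpace ℝ (Fin (n + 2))) :
    ambientCLM n ε v w = ambientForm ε v w := rfl

lemma ambientCLM_comm (ε : ℝ) (v w : EuclideanSpace ℝ (Fin (n + 2))) :
    ambientCLM n ε v w = ambientCLM n ε w v := by
  simp [ambientCLM_apply, ambientForm, mul_comm]

end Ambient

/-! ### Smooth local orthonormal frames -/

section Frame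

variable {n : ℕ} {M : Type*} [TopologicalSpace M] [ChartedSpace (EuclideanSpace ℝ (Fin n)) M]
  [IsManifold (𝓡 n) ∞ M]

lemma SmoothFieldAt.sum_smul {ι : Type*} (s : Finset ι) {a : ι → M → ℝ}
    {X : ι → Π x : M, TangentSpace (𝓡 n) x} {x : M}
    (ha : ∀ i ∈ s, ContMDiffAt (𝓡 n) 𝓘(ℝ) ∞ (a i) x) (hX : ∀ i ∈ s, SmoothFieldAt (X i) x) :
    SmoothFieldAt (fun p ↦ ∑ i ∈ s, a i p • X i p) x :=
  ContMDiffAt.sum_section fun i hi ↦ (ha i hi).smul_section (hX i hi)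

variable [RiemannianBundle (fun x : M ↦ TangentSpace (𝓡 n) x)]
  [IsContMDiffRiemannianBundle (𝓡 n) ∞ (EuclideanSpace ℝ (Fin n))
    (fun x : M ↦ TangentSpace (𝓡 n) x)]

lemma SmoothFieldAt.contMDiffAt_inner {X Y : Π x : M, TangentSpace (𝓡 n) x} {x : M}
    (hX : SmoothFieldAt X x) (hY : SmoothFieldAt Y x) :
    ContMDiffAt (𝓡 n) 𝓘(ℝ) ∞ (fun p ↦ inner ℝ (X p) (Y p)) x :=
  ContMDiffAt.inner_bundle (F := EuclideanSpace ℝ (Fin n))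
    (E := fun x : M ↦ TangentSpace (𝓡 n) x) (b := id) hX hY

/-- Strong induction on the recursive formula: the coefficients are quotients of smooth inner
products, and independence at `x` keeps the denominators nonzero there. -/
lemma SmoothFieldAt.gramSchmidt {ι : Type*} [LinearOrder ι] [LocallyFiniteOrderBot ι]
    [WellFoundedLT ι] {X : ι → Π x : M, TangentSpace (𝓡 n) x} {x : M}
    (hX : ∀ i, SmoothFieldAt (X i) x) (hli : LinearIndependent ℝ fun i ↦ X i x) (i : ι) :
    SmoothFieldAt (fun p ↦ InnerProductSpace.gramSchmidt ℝ (fun j ↦ X j p) i) x := by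
  induction i using WellFoundedLT.induction with
  | ind i ih =>
  have hdef : (fun p ↦ InnerProductSpace.gramSchmidt ℝ (fun j ↦ X j p) i) = X i - fun p ↦
      ∑ j ∈ Finset.Iio i, (inner ℝ (InnerProductSpace.gramSchmidt ℝ (fun k ↦ X k p) j) (X i p) /
        inner ℝ (InnerProductSpace.gramSchmidt ℝ (fun k ↦ X k p) j)
          (InnerProductSpace.gramSchmidt ℝ (fun k ↦ X k p) j)) •
        InnerProductSpace.gramSchmidt ℝ (fun k ↦ X k p) j := by
    funext p
    rw [InnerProductSpace.gramSchmidt_def]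
    simp [Submodule.starProjection_singleton]
  rw [hdef]
  refine ContMDiffAt.sub_section (hX i) (SmoothFieldAt.sum_smul _ (fun j hj ↦ ?_) fun j hj ↦ ?_)
  · have hj' := ih j (Finset.mem_Iio.1 hj)
    exact (hj'.contMDiffAt_inner (hX i)).div₀ (hj'.contMDiffAt_inner hj')
      (inner_self_ne_zero.2 (InnerProductSpace.gramSchmidt_ne_zero j hli))
  · exact ih j (Finset.mem_Iio.1 hj)

/-- Near every point there is a smooth orthonormal frame of the tangent bundle. -/
lemma exists_orthonormal_frame (x : M) : ∃ E : Fin n → Π p : M, TangentSpace (𝓡 n) p,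
    ∀ᶠ p in 𝓝 x, (∀ i, SmoothFieldAt (E i) p) ∧ Orthonormal ℝ fun i ↦ E i p := by
  let e := trivializationAt (EuclideanSpace ℝ (Fin n)) (fun x : M ↦ TangentSpace (𝓡 n) x) x
  let b := (EuclideanSpace.basisFun (Fin n) ℝ).toBasis
  have hfr := e.isLocalFrameOn_localFrame_baseSet (𝓡 n) ∞ b
  refine ⟨fun i p ↦ InnerProductSpace.gramSchmidtNormed ℝ (fun j ↦ e.localFrame b j p) i, ?_⟩
  filter_upwards [e.open_baseSet.mem_nhds (FiberBundle.mem_baseSet_trivializationAt' x)] with p hp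
  have hli := hfr.linearIndependent hp
  refine ⟨fun i ↦ ?_, InnerProductSpace.gramSchmidtNormed_orthonormal hli⟩
  have hgs := SmoothFieldAt.gramSchmidt (fun i ↦ hfr.contMDiffAt e.open_baseSet hp i) hli i
  have hne := InnerProductSpace.gramSchmidt_ne_zero i hli
  have hnorm : ContMDiffAt (𝓡 n) 𝓘(ℝ) ∞ (fun q ↦
      ‖InnerProductSpace.gramSchmidt ℝ (fun j ↦ e.localFrame b j q) i‖⁻¹) p := by
    simp only [norm_eq_sqrt_real_inner]
    have h := (Real.contDiffAt_sqrt (n := ∞) (inner_self_ne_zero.2 hne)).contMDiffAt.comp p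
      (hgs.contMDiffAt_inner hgs)
    refine ContMDiffAt.inv₀ h ?_
    simpa [Real.sqrt_eq_zero'] using hne
  exact hnorm.smul_section hgs

end Frame

/-! ### Orthogonal projection to the normal space -/

section Normal

variable {n : ℕ} {M : Type*} [TopologicalSpace M] [ChartedSpace (EuclideanSpace ℝ (Fin n)) M]
  [RiemannianBundle (fun x : M ↦ TangentSpace (𝓡 n) x)]
  {ε : ℝ} {g : M → EuclideanSpace ℝ (Fin (n + 2))}

lemma IsIsometricImmersion.ambientCLM_eq (hg : IsIsometricImmersion ε g) (x : M)
    (u v : TangentSpace (𝓡 n) x) :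
    ambientCLM n ε (differential g x u) (differential g x v) = inner ℝ u v :=
  hg.isometric x u v

/-- A vector both tangent and normal has zero square, and the metric induced on tangent vectors is
positive definite. Hence the decomposition is unique even in the Lorentzian case. -/
lemma eq_of_mem_normalSpace (hg : IsIsometricImmersion ε g) {x : M}
    {v w : EuclideanSpace ℝ (Fin (n + 2))} (hv : v ∈ normalSpace ε g x)
    (hw : w ∈ normalSpace ε g x) (h : v - w ∈ (differential g x).range) : v = w := by
  obtain ⟨u, hu⟩ := h
  have h0 : ambientForm ε (v - w) (differential g x u) = 0 := Submodule.sub_mem _ hv hw u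
  have hu' : differential g x u = v - w := hu
  rw [← hu', hg.isometric, inner_self_eq_zero] at h0
  rw [h0, map_zero] at hu'
  exact (sub_eq_zero.1 hu'.symm)

/-- The normal part is the normal component of the orthogonal decomposition. -/
lemma normalPart_eq (hg : IsIsometricImmersion ε g) {x : M}
    {v w : EuclideanSpace ℝ (Fin (n + 2))} (hw : w ∈ normalSpace ε g x)
    (h : v - w ∈ (differential g x).range) : normalPart ε g x v = w := by
  refine eq_of_mem_normalSpace hg (normalPart_mem_normalSpace hg x v) hw ?_
  have := Submodule.sub_mem _ h (sub_normalPart_mem_range ε g x v)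
  simpa using this

/-- The normal part as a linear map. -/
noncomputable def normalProj (hg : IsIsometricImmersion ε g) (x : M) :
    EuclideanSpace ℝ (Fin (n + 2)) →ₗ[ℝ] EuclideanSpace ℝ (Fin (n + 2)) where
  toFun := normalPart ε g x
  map_add' v w := by
    refine normalPart_eq hg (Submodule.add_mem _ (normalPart_mem_normalSpace hg x v)
      (normalPart_mem_normalSpace hg x w)) ?_
    rw [add_sub_add_comm]
    exact Submodule.add_mem _ (sub_normalPart_mem_range ε g x v) (sub_normalPart_mem_range ε g x w)
  map_smul' a v := by
    refine normalPart_eq hg (Submodule.smul_mem _ _ (normalPart_mem_normalSpace hg x v)) ?_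
    rw [RingHom.id_apply, ← smul_sub]
    exact Submodule.smul_mem _ _ (sub_normalPart_mem_range ε g x v)

lemma normalProj_apply (hg : IsIsometricImmersion ε g) (x : M)
    (v : EuclideanSpace ℝ (Fin (n + 2))) : normalProj hg x v = normalPart ε g x v := rfl

lemma normalProj_mem (hg : IsIsometricImmersion ε g) (x : M)
    (v : EuclideanSpace ℝ (Fin (n + 2))) : normalProj hg x v ∈ normalSpace ε g x :=
  normalPart_mem_normalSpace hg x v

@[simp]
lemma normalProj_differential (hg : IsIsometricImmersion ε g) (x : M)
    (u : TangentSpace (𝓡 n) x) : normalProj hg x (differential g x u) = 0 :=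
  normalPart_eq hg (Submodule.zero_mem _) ⟨u, by simp⟩

lemma ambientCLM_normalProj_left (hg : IsIsometricImmersion ε g) (x : M)
    {v w : EuclideanSpace ℝ (Fin (n + 2))} (hw : w ∈ normalSpace ε g x) :
    ambientCLM n ε (normalProj hg x v) w = ambientCLM n ε v w := by
  obtain ⟨u, hu⟩ := sub_normalPart_mem_range ε g x v
  have hu' : differential g x u = v - normalPart ε g x v := hu
  have := hw u
  rw [← ambientCLM_apply, hu', ambientCLM_comm, map_sub, sub_apply,
    sub_eq_zero] at this
  exact this.symm

lemma exists_orthonormalBasis_eq {x : M} {e : Fin n → TangentSpace (𝓡 n) x}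
    (he : Orthonormal ℝ e) :
    ∃ b : OrthonormalBasis (Fin n) ℝ (TangentSpace (𝓡 n) x), ∀ i, b i = e i := by
  have hcard : Fintype.card (Fin n) = Module.finrank ℝ (TangentSpace (𝓡 n) x) := by
    rw [Fintype.card_fin]
    exact finrank_euclideanSpace_fin.symm
  have hspan := he.linearIndependent.span_eq_top_of_card_eq_finrank' hcard
  exact ⟨OrthonormalBasis.mk he hspan.ge, by simp⟩

lemma sum_inner_smul_of_orthonormal {x : M} {e : Fin n → TangentSpace (𝓡 n) x}
    (he : Orthonormal ℝ e) (u : TangentSpace (𝓡 n) x) : ∑ i, inner ℝ (e i) u • e i = u := by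
  obtain ⟨b, hb⟩ := exists_orthonormalBasis_eq he
  simpa [hb] using b.sum_repr' u

/-- The normal part in terms of an arbitrary orthonormal basis of the tangent space. -/
lemma normalProj_eq_sub_sum (hg : IsIsometricImmersion ε g) {x : M}
    {e : Fin n → TangentSpace (𝓡 n) x} (he : Orthonormal ℝ e)
    (v : EuclideanSpace ℝ (Fin (n + 2))) :
    normalProj hg x v = v - ∑ i, ambientCLM n ε v (differential g x (e i)) •
      differential g x (e i) := by
  refine normalPart_eq hg (fun u ↦ ?_) ?_
  · rw [← ambientCLM_apply]
    conv_lhs => rw [map_sub, sub_apply, map_sum, sum_apply]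
    simp only [map_smul, smul_apply, hg.ambientCLM_eq, smul_eq_mul]
    rw [sub_eq_zero]
    nth_rewrite 1 [← sum_inner_smul_of_orthonormal he u]
    simp only [map_sum, map_smul, smul_eq_mul]
    exact Finset.sum_congr rfl fun i _ ↦ mul_comm _ _
  · rw [sub_sub_cancel]
    exact Submodule.sum_mem _ fun i _ ↦ Submodule.smul_mem _ _ ⟨_, rfl⟩

end Normal

/-! ### Calculus of derivatives along fields -/

section FieldDeriv

variable {n : ℕ} {M : Type*} [TopologicalSpace M] [ChartedSpace (EuclideanSpace ℝ (Fin n)) M]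
  {F : Type*} [NormedAddCommGroup F] [NormedSpace ℝ F]

/-- The derivative of a vector-valued function along a vector field. -/
noncomputable def fieldDeriv (X : Π p : M, TangentSpace (𝓡 n) p) (f : M → F) (p : M) : F :=
  mvfderiv (𝓡 n) f p (X p)

lemma fieldDeriv_congr {f h : M → F} {x : M} (hfh : f =ᶠ[𝓝 x] h)
    (X : Π p : M, TangentSpace (𝓡 n) p) : fieldDeriv X f x = fieldDeriv X h x := by
  simp only [fieldDeriv, mvfderiv_congr hfh]

lemma fieldDeriv_sub {f h : M → F} {x : M} (hf : ContMDiffAt (𝓡 n) 𝓘(ℝ, F) ∞ f x)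
    (hh : ContMDiffAt (𝓡 n) 𝓘(ℝ, F) ∞ h x) (X : Π p : M, TangentSpace (𝓡 n) p) :
    fieldDeriv X (fun p ↦ f p - h p) x = fieldDeriv X f x - fieldDeriv X h x := by
  have := mvfderiv_sub (hf.mdifferentiableAt (by simp)) (hh.mdifferentiableAt (by simp))
  exact congr($this (X x))

lemma fieldDeriv_bilinear {F₁ F₂ : Type*} [NormedAddCommGroup F₁] [NormedSpace ℝ F₁]
    [NormedAddCommGroup F₂] [NormedSpace ℝ F₂] (B : F₁ →L[ℝ] F₂ →L[ℝ] F) {f : M → F₁} {h : M → F₂}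
    {x : M} (hf : ContMDiffAt (𝓡 n) 𝓘(ℝ, F₁) ∞ f x) (hh : ContMDiffAt (𝓡 n) 𝓘(ℝ, F₂) ∞ h x)
    (X : Π p : M, TangentSpace (𝓡 n) p) :
    fieldDeriv X (fun p ↦ B (f p) (h p)) x =
      B (fieldDeriv X f x) (h x) + B (f x) (fieldDeriv X h x) :=
  mvfderiv_bilinear B (hf.mdifferentiableAt (by simp)) (hh.mdifferentiableAt (by simp)) (X x)

lemma fieldDeriv_sum_smul {ι : Type*} (s : Finset ι) {a : ι → M → ℝ} {f : ι → M → F} {x : M}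
    (ha : ∀ i, ContMDiffAt (𝓡 n) 𝓘(ℝ) ∞ (a i) x) (hf : ∀ i, ContMDiffAt (𝓡 n) 𝓘(ℝ, F) ∞ (f i) x)
    (X : Π p : M, TangentSpace (𝓡 n) p) :
    fieldDeriv X (fun p ↦ ∑ i ∈ s, a i p • f i p) x =
      ∑ i ∈ s, (fieldDeriv X (a i) x • f i x + a i x • fieldDeriv X (f i) x) := by
  classical
  induction s using Finset.induction_on with
  | empty => simp [fieldDeriv, mvfderiv_const]
  | insert j s hj ih =>
    have h1 : ContMDiffAt (𝓡 n) 𝓘(ℝ, F) ∞ (fun p ↦ a j p • f j p) x := (ha j).smul (hf j)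
    have h2 : ContMDiffAt (𝓡 n) 𝓘(ℝ, F) ∞ (fun p ↦ ∑ i ∈ s, a i p • f i p) x :=
      contMDiffAt_finsetSum fun i _ ↦ (ha i).smul (hf i)
    have h3 := mvfderiv_add (h1.mdifferentiableAt (by simp)) (h2.mdifferentiableAt (by simp))
    have h4 := fieldDeriv_bilinear (ContinuousLinearMap.lsmul ℝ ℝ) (ha j) (hf j) X
    simp only [Finset.sum_insert hj]
    rw [← ih]
    calc _ = fieldDeriv X (fun p ↦ a j p • f j p) x
          + fieldDeriv X (fun p ↦ ∑ i ∈ s, a i p • f i p) x := congr($h3 (X x))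
      _ = _ := congrArg (· + _) h4

variable [IsManifold (𝓡 n) ∞ M]

lemma contMDiffAt_fieldDeriv {f : M → F} {Y : Π p : M, TangentSpace (𝓡 n) p} {x : M}
    (hY : SmoothFieldAt Y x) (hf : ContMDiffAt (𝓡 n) 𝓘(ℝ, F) ∞ f x) :
    ContMDiffAt (𝓡 n) 𝓘(ℝ, F) ∞ (fieldDeriv Y f) x :=
  contMDiffAt_mvfderiv_apply hf hY

lemma fieldDeriv_mlieBracket {f : M → F} {X Y : Π p : M, TangentSpace (𝓡 n) p} {x : M}
    (hX : SmoothFieldAt X x) (hY : SmoothFieldAt Y x) (hf : ContMDiffAt (𝓡 n) 𝓘(ℝ, F) ∞ f x) :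
    fieldDeriv (mlieBracket (𝓡 n) X Y) f x =
      fieldDeriv X (fieldDeriv Y f) x - fieldDeriv Y (fieldDeriv X f) x :=
  mvfderiv_mlieBracket hf hX hY

lemma SmoothFieldAt.mlieBracket {X Y : Π p : M, TangentSpace (𝓡 n) p} {x : M}
    (hX : SmoothFieldAt X x) (hY : SmoothFieldAt Y x) :
    SmoothFieldAt (mlieBracket (𝓡 n) X Y) x := by
  have : IsManifold (𝓡 n) ((⊤ : ℕ∞) + 1) M := inferInstanceAs (IsManifold (𝓡 n) ∞ M)
  have hmin : minSmoothness ℝ 2 ≤ (∞ : WithTop ℕ∞) := by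
    rw [minSmoothness_of_isRCLikeNormedField]
    norm_cast
  have : IsManifold (𝓡 n) (minSmoothness ℝ 2) M := .of_le (n := ∞) hmin
  refine ContMDiffAt.mlieBracket_vectorField (n := ⊤) (m := ⊤) hX hY ?_
  rw [minSmoothness_of_isRCLikeNormedField]
  exact le_rfl

end FieldDeriv

/-! ### Gauss formula and Gauss equation -/

section Gauss

variable {n : ℕ} {M : Type*} [TopologicalSpace M] [ChartedSpace (EuclideanSpace ℝ (Fin n)) M]
  [IsManifold (𝓡 n) ∞ M]
  [RiemannianBundle (fun x : M ↦ TangentSpace (𝓡 n) x)]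
  [IsContMDiffRiemannianBundle (𝓡 n) ∞ (EuclideanSpace ℝ (Fin n))
    (fun x : M ↦ TangentSpace (𝓡 n) x)]
  {ε : ℝ} {g : M → EuclideanSpace ℝ (Fin (n + 2))}

/-- Lets identities proved for smooth fields be tested on single tangent vectors. -/
lemma exists_smoothField (x : M) (u : TangentSpace (𝓡 n) x) :
    ∃ Z : Π p : M, TangentSpace (𝓡 n) p, SmoothFieldAt Z x ∧ Z x = u := by
  obtain ⟨E, hE⟩ := exists_orthonormal_frame (n := n) x
  obtain ⟨hs, ho⟩ := hE.self_of_nhds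
  exact ⟨fun p ↦ ∑ i, inner ℝ (E i x) u • E i p,
    SmoothFieldAt.sum_smul _ (fun _ _ ↦ contMDiffAt_const) fun i _ ↦ hs i,
    sum_inner_smul_of_orthonormal ho u⟩

variable {cov : CovariantDerivative (𝓡 n) (EuclideanSpace ℝ (Fin n))
    (fun x : M ↦ TangentSpace (𝓡 n) x)}

/-- The Levi-Civita connection is the tangential component of the derivative in the ambient
space. -/
lemma inner_leviCivita (hg : IsIsometricImmersion ε g) (hcov : IsLeviCivita cov) {p : M}
    {X Y Z : Π p : M, TangentSpace (𝓡 n) p} (hX : SmoothFieldAt X p) (hY : SmoothFieldAt Y p)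
    (hZ : SmoothFieldAt Z p) :
    inner ℝ (cov Y p (X p)) (Z p) =
      ambientCLM n ε (fieldDeriv X (fieldDeriv Y g) p) (fieldDeriv Z g p) := by
  have : IsContMDiffRiemannianBundle (𝓡 n) 1 (EuclideanSpace ℝ (Fin n))
      (fun x : M ↦ TangentSpace (𝓡 n) x) :=
    IsContMDiffRiemannianBundle.of_le (n := ∞) (by norm_cast)
  obtain ⟨htor, hmet⟩ := hcov
  have hdiff {W : Π p : M, TangentSpace (𝓡 n) p} (hW : SmoothFieldAt W p) :
      MDifferentiableAt (𝓡 n) (𝓡 n).tangent (fun p ↦ (⟨p, W p⟩ : TangentBundle (𝓡 n) M)) p :=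
    ContMDiffAt.mdifferentiableAt hW (by simp)
  have hgp : ContMDiffAt (𝓡 n) 𝓘(ℝ, EuclideanSpace ℝ (Fin (n + 2))) ∞ g p := hg.contMDiff p
  -- The defect `S` is symmetric in its first two arguments (zero torsion and the bracket rule
  -- applied to `g`) and antisymmetric in its last two (metric compatibility and the product rule).
  -- Alternating the two symmetries six times gives `S = -S`.
  let S (X Y Z : Π p : M, TangentSpace (𝓡 n) p) : ℝ := inner ℝ (cov Y p (X p)) (Z p) -
    ambientCLM n ε (fieldDeriv X (fieldDeriv Y g) p) (fieldDeriv Z g p)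
  have hsymm {X Y Z : Π p : M, TangentSpace (𝓡 n) p} (hX : SmoothFieldAt X p)
      (hY : SmoothFieldAt Y p) : S X Y Z = S Y X Z := by
    have h1 := (CovariantDerivative.torsion_eq_zero_iff cov).1 htor (hdiff hX) (hdiff hY)
    have h2 := fieldDeriv_mlieBracket hX hY hgp
    have h3 : inner ℝ (cov Y p (X p)) (Z p) - inner ℝ (cov X p (Y p)) (Z p) =
        ambientCLM n ε (fieldDeriv X (fieldDeriv Y g) p) (fieldDeriv Z g p) -
        ambientCLM n ε (fieldDeriv Y (fieldDeriv X g) p) (fieldDeriv Z g p) := by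
      rw [← inner_sub_left, h1, ← sub_apply, ← map_sub, ← h2]
      exact (hg.ambientCLM_eq p _ _).symm
    simp only [S]
    linarith
  have hanti {X Y Z : Π p : M, TangentSpace (𝓡 n) p}
      (hY : SmoothFieldAt Y p) (hZ : SmoothFieldAt Z p) : S X Y Z = - S X Z Y := by
    have h1 := hmet.mvfderiv_inner_eq X (hdiff hY) (hdiff hZ)
    have h2 := fieldDeriv_bilinear (ambientCLM n ε) (contMDiffAt_fieldDeriv hY hgp)
      (contMDiffAt_fieldDeriv hZ hgp) X
    have h3 : (fun q ↦ ambientCLM n ε (fieldDeriv Y g q) (fieldDeriv Z g q)) =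
        fun q ↦ inner ℝ (Y q) (Z q) := funext fun q ↦ hg.ambientCLM_eq q _ _
    rw [h3] at h2
    have h4 : inner ℝ (cov Y p (X p)) (Z p) + inner ℝ (Y p) (cov Z p (X p)) = _ := h1.symm.trans h2
    rw [ambientCLM_comm ε (fieldDeriv Y g p), real_inner_comm (cov Z p (X p))] at h4
    simp only [S]
    linarith
  have h0 : S X Y Z = 0 := by
    have e1 : S X Y Z = - S X Z Y := hanti hY hZ
    have e2 : S X Z Y = S Z X Y := hsymm hX hZ
    have e3 : S Z X Y = - S Z Y X := hanti hX hY
    have e4 : S Z Y X = S Y Z X := hsymm hZ hY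
    have e5 : S Y Z X = - S Y X Z := hanti hZ hX
    have e6 : S Y X Z = S X Y Z := hsymm hY hX
    linarith
  exact sub_eq_zero.1 h0

/-- The Gauss formula. -/
lemma normalProj_fieldDeriv (hg : IsIsometricImmersion ε g) (hcov : IsLeviCivita cov) {p : M}
    {Y Z : Π p : M, TangentSpace (𝓡 n) p} (hY : SmoothFieldAt Y p) (hZ : SmoothFieldAt Z p) :
    normalProj hg p (fieldDeriv Y (fieldDeriv Z g) p) =
      fieldDeriv Y (fieldDeriv Z g) p - fieldDeriv (fun q ↦ cov Z q (Y q)) g p := by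
  refine normalPart_eq hg (fun u ↦ ?_) ?_
  · obtain ⟨U, hU, rfl⟩ := exists_smoothField p u
    have h := inner_leviCivita hg hcov hY hZ hU
    rw [← ambientCLM_apply, map_sub, sub_apply, sub_eq_zero]
    exact h.symm.trans (hg.ambientCLM_eq p _ _).symm
  · rw [sub_sub_cancel]
    exact ⟨_, rfl⟩

/-- Covariant derivatives of smooth fields are smooth. -/
lemma IsLeviCivita.smoothFieldAt (hg : IsIsometricImmersion ε g) (hcov : IsLeviCivita cov) {x : M}
    {Y Z : Π p : M, TangentSpace (𝓡 n) p} (hY : ∀ᶠ p in 𝓝 x, SmoothFieldAt Y p)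
    (hZ : ∀ᶠ p in 𝓝 x, SmoothFieldAt Z p) : SmoothFieldAt (fun p ↦ cov Z p (Y p)) x := by
  obtain ⟨E, hE⟩ := exists_orthonormal_frame (n := n) x
  -- Smoothness is not part of `IsLeviCivita`; it comes from the frame coefficients, which
  -- `inner_leviCivita` writes as ambient derivatives.
  have h1 : SmoothFieldAt (fun p ↦ ∑ i, ambientCLM n ε (fieldDeriv Y (fieldDeriv Z g) p)
      (fieldDeriv (E i) g p) • E i p) x := by
    refine SmoothFieldAt.sum_smul _ (fun i _ ↦ ?_) fun i _ ↦ hE.self_of_nhds.1 i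
    have h2 := contMDiffAt_fieldDeriv hY.self_of_nhds
      (contMDiffAt_fieldDeriv hZ.self_of_nhds (hg.contMDiff x))
    have h3 := contMDiffAt_fieldDeriv (hE.self_of_nhds.1 i) (hg.contMDiff x)
    exact ((ambientCLM n ε).contMDiff.contMDiffAt.comp x h2).clm_apply h3
  refine ContMDiffAt.congr_of_eventuallyEq h1 ?_
  filter_upwards [hE, hY, hZ] with p ⟨hEs, hEo⟩ hYp hZp
  have h4 := sum_inner_smul_of_orthonormal hEo (cov Z p (Y p))
  have h5 : ∀ i, inner ℝ (E i p) (cov Z p (Y p)) =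
      ambientCLM n ε (fieldDeriv Y (fieldDeriv Z g) p) (fieldDeriv (E i) g p) := fun i ↦ by
    rw [real_inner_comm, inner_leviCivita hg hcov hYp hZp (hEs i)]
  simp only [h5] at h4
  rw [h4]

/-- By the Gauss formula, `D_Y D_Z g` minus the image of `∇_Y Z` is normal, so its product with `D_W
g` vanishes near `x`. Differentiating this along `X` gives the identity, the last term being the
product of two second fundamental forms. -/
lemma inner_cov_cov (hg : IsIsometricImmersion ε g) (hcov : IsLeviCivita cov) {x : M}
    {X Y Z W : Π p : M, TangentSpace (𝓡 n) p} (hX : SmoothFieldAt X x)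
    (hY : ∀ᶠ p in 𝓝 x, SmoothFieldAt Y p) (hZ : ∀ᶠ p in 𝓝 x, SmoothFieldAt Z p)
    (hW : SmoothFieldAt W x) :
    inner ℝ (cov (fun p ↦ cov Z p (Y p)) x (X x)) (W x) =
      ambientCLM n ε (fieldDeriv X (fieldDeriv Y (fieldDeriv Z g)) x) (fieldDeriv W g x) +
        ambientCLM n ε (normalProj hg x (fieldDeriv Y (fieldDeriv Z g) x))
          (normalProj hg x (fieldDeriv X (fieldDeriv W g) x)) := by
  have hP := hcov.smoothFieldAt hg hY hZ
  rw [inner_leviCivita hg hcov hX hP hW]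
  have hYZ := contMDiffAt_fieldDeriv hY.self_of_nhds
      (contMDiffAt_fieldDeriv hZ.self_of_nhds (hg.contMDiff x))
  have hPg := contMDiffAt_fieldDeriv hP (hg.contMDiff x)
  have hWg := contMDiffAt_fieldDeriv hW (hg.contMDiff x)
  have h1 := fieldDeriv_bilinear (ambientCLM n ε) (f := fun p ↦ fieldDeriv Y (fieldDeriv Z g) p -
    fieldDeriv (fun q ↦ cov Z q (Y q)) g p) (hYZ.sub hPg) hWg X
  have h2 : (fun p ↦ ambientCLM n ε (fieldDeriv Y (fieldDeriv Z g) p -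
      fieldDeriv (fun q ↦ cov Z q (Y q)) g p) (fieldDeriv W g p)) =ᶠ[𝓝 x] fun _ ↦ 0 := by
    filter_upwards [hY, hZ] with p hYp hZp
    rw [← normalProj_fieldDeriv hg hcov hYp hZp]
    exact normalProj_mem hg p _ (W p)
  have h3 : fieldDeriv X (fun _ : M ↦ (0 : ℝ)) x = 0 := by simp [fieldDeriv, mvfderiv_const]
  rw [fieldDeriv_congr h2, h3] at h1
  rw [fieldDeriv_sub hYZ hPg, ← normalProj_fieldDeriv hg hcov hY.self_of_nhds hZ.self_of_nhds,
    map_sub, sub_apply] at h1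
  rw [ambientCLM_comm ε (normalProj hg x (fieldDeriv Y (fieldDeriv Z g) x)),
    ambientCLM_normalProj_left hg x (normalProj_mem hg x _), ambientCLM_comm ε _ (normalProj _ _ _)]
  linarith

/-- The Gauss equation. -/
theorem gauss_equation (hg : IsIsometricImmersion ε g) (hcov : IsLeviCivita cov) {x : M}
    {X Y Z W : Π p : M, TangentSpace (𝓡 n) p} (hX : ∀ᶠ p in 𝓝 x, SmoothFieldAt X p)
    (hY : ∀ᶠ p in 𝓝 x, SmoothFieldAt Y p) (hZ : ∀ᶠ p in 𝓝 x, SmoothFieldAt Z p)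
    (hW : SmoothFieldAt W x) :
    inner ℝ (curvature cov X Y Z x) (W x) =
      ambientCLM n ε (normalProj hg x (fieldDeriv Y (fieldDeriv Z g) x))
          (normalProj hg x (fieldDeriv X (fieldDeriv W g) x)) -
      ambientCLM n ε (normalProj hg x (fieldDeriv X (fieldDeriv Z g) x))
          (normalProj hg x (fieldDeriv Y (fieldDeriv W g) x)) := by
  have hX' := hX.self_of_nhds
  have hY' := hY.self_of_nhds
  have hZ' := hZ.self_of_nhds
  -- Applied to `D_Z g`, this makes the third derivatives of `g` cancel.
  have h1 := fieldDeriv_mlieBracket hX' hY' (contMDiffAt_fieldDeriv hZ' (hg.contMDiff x))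
  rw [curvature, inner_sub_left, inner_sub_left, inner_cov_cov hg hcov hX' hY hZ hW,
    inner_cov_cov hg hcov hY' hX hZ hW, inner_leviCivita hg hcov (hX'.mlieBracket hY') hZ' hW,
    h1, map_sub, sub_apply]
  ring

end Gauss

/-! ### Ricci equation -/

section Ricci

variable {n : ℕ} {M : Type*} [TopologicalSpace M] [ChartedSpace (EuclideanSpace ℝ (Fin n)) M]
  [IsManifold (𝓡 n) ∞ M]
  [RiemannianBundle (fun x : M ↦ TangentSpace (𝓡 n) x)]
  {ε : ℝ} {g : M → EuclideanSpace ℝ (Fin (n + 2))}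
  {E : Fin n → Π p : M, TangentSpace (𝓡 n) p} {x : M}

/-- Near `x`, `∇^⊥_Y ξ` is `D_Y ξ` minus its expansion in the tangent frame `D_{Eᵢ} g`. After
differentiation along `X` and projection, the terms where a coefficient is differentiated remain
tangent and disappear. -/
lemma normalConnection_normalConnection (hg : IsIsometricImmersion ε g)
    (hE : ∀ᶠ p in 𝓝 x, (∀ i, SmoothFieldAt (E i) p) ∧ Orthonormal ℝ fun i ↦ E i p)
    {X Y : Π p : M, TangentSpace (𝓡 n) p} {ξ : M → EuclideanSpace ℝ (Fin (n + 2))}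
    (hY : SmoothFieldAt Y x)
    (hξ : ContMDiffAt (𝓡 n) 𝓘(ℝ, EuclideanSpace ℝ (Fin (n + 2))) ∞ ξ x)
    (hn : ∀ p, ξ p ∈ normalSpace ε g p) :
    normalConnection ε g X (normalConnection ε g Y ξ) x =
      normalProj hg x (fieldDeriv X (fieldDeriv Y ξ) x) +
      ∑ i, ambientCLM n ε (ξ x) (normalProj hg x (fieldDeriv Y (fieldDeriv (E i) g) x)) •
        normalProj hg x (fieldDeriv X (fieldDeriv (E i) g) x) := by
  have hYξ := contMDiffAt_fieldDeriv hY hξ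
  have hEg : ∀ i, ContMDiffAt (𝓡 n) 𝓘(ℝ, EuclideanSpace ℝ (Fin (n + 2))) ∞
      (fieldDeriv (E i) g) x :=
    fun i ↦ contMDiffAt_fieldDeriv (hE.self_of_nhds.1 i) (hg.contMDiff x)
  have ha : ∀ i, ContMDiffAt (𝓡 n) 𝓘(ℝ) ∞ (fun p ↦
      ambientCLM n ε (fieldDeriv Y ξ p) (fieldDeriv (E i) g p)) x := fun i ↦
    ((ambientCLM n ε).contMDiff.contMDiffAt.comp x hYξ).clm_apply (hEg i)
  have h1 : normalConnection ε g Y ξ =ᶠ[𝓝 x] fun p ↦ fieldDeriv Y ξ p -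
      ∑ i, ambientCLM n ε (fieldDeriv Y ξ p) (fieldDeriv (E i) g p) • fieldDeriv (E i) g p := by
    filter_upwards [hE] with p ⟨_, hEo⟩
    exact normalProj_eq_sub_sum hg hEo _
  have h2 : normalConnection ε g X (normalConnection ε g Y ξ) x =
      normalProj hg x (fieldDeriv X (normalConnection ε g Y ξ) x) := rfl
  have h3 : ∀ i, normalProj hg x (fieldDeriv (E i) g x) = 0 :=
    fun i ↦ normalProj_differential hg x _
  -- Differentiate `⟨ξ, D_{Eᵢ} g⟩ = 0` along `Y`.
  have h4 : ∀ i, ambientCLM n ε (fieldDeriv Y ξ x) (fieldDeriv (E i) g x) =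
      - ambientCLM n ε (ξ x) (normalProj hg x (fieldDeriv Y (fieldDeriv (E i) g) x)) := by
    intro i
    have h5 := fieldDeriv_bilinear (ambientCLM n ε) hξ (hEg i) Y
    have h6 : (fun p ↦ ambientCLM n ε (ξ p) (fieldDeriv (E i) g p)) = fun _ ↦ 0 :=
      funext fun p ↦ hn p _
    have h7 : fieldDeriv Y (fun _ : M ↦ (0 : ℝ)) x = 0 := by simp [fieldDeriv, mvfderiv_const]
    rw [h6, h7] at h5
    rw [ambientCLM_comm ε (ξ x), ambientCLM_normalProj_left hg x (hn x), ambientCLM_comm ε _ (ξ x)]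
    linarith
  have hsum : ContMDiffAt (𝓡 n) 𝓘(ℝ, EuclideanSpace ℝ (Fin (n + 2))) ∞ (fun p ↦
      ∑ i, ambientCLM n ε (fieldDeriv Y ξ p) (fieldDeriv (E i) g p) • fieldDeriv (E i) g p) x :=
    contMDiffAt_finsetSum fun i _ ↦ (ha i).smul (hEg i)
  rw [h2, fieldDeriv_congr h1, fieldDeriv_sub hYξ hsum, fieldDeriv_sum_smul _ ha hEg,
    map_sub, map_sum, sub_eq_add_neg, ← Finset.sum_neg_distrib]
  simp only [map_add, map_smul, map_neg, h3, h4, smul_zero, zero_add, neg_smul, neg_neg]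

/-- The Ricci equation. -/
theorem ricci_equation (hg : IsIsometricImmersion ε g)
    (hE : ∀ᶠ p in 𝓝 x, (∀ i, SmoothFieldAt (E i) p) ∧ Orthonormal ℝ fun i ↦ E i p)
    {X Y : Π p : M, TangentSpace (𝓡 n) p} {ξ : M → EuclideanSpace ℝ (Fin (n + 2))}
    (hX : SmoothFieldAt X x) (hY : SmoothFieldAt Y x)
    (hξ : ContMDiffAt (𝓡 n) 𝓘(ℝ, EuclideanSpace ℝ (Fin (n + 2))) ∞ ξ x)
    (hn : ∀ p, ξ p ∈ normalSpace ε g p) :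
    normalCurvature ε g X Y ξ x =
      ∑ i, ambientCLM n ε (ξ x) (normalProj hg x (fieldDeriv Y (fieldDeriv (E i) g) x)) •
        normalProj hg x (fieldDeriv X (fieldDeriv (E i) g) x) -
      ∑ i, ambientCLM n ε (ξ x) (normalProj hg x (fieldDeriv X (fieldDeriv (E i) g) x)) •
        normalProj hg x (fieldDeriv Y (fieldDeriv (E i) g) x) := by
  have h1 : normalConnection ε g (mlieBracket (𝓡 n) X Y) ξ x =
      normalProj hg x (fieldDeriv (mlieBracket (𝓡 n) X Y) ξ x) := rfl
  rw [normalCurvature, normalConnection_normalConnection hg hE hY hξ hn,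
    normalConnection_normalConnection hg hE hX hξ hn, h1, fieldDeriv_mlieBracket hX hY hξ, map_sub]
  abel

end Ricci

/-! ### From the Gauss equation to the symmetry of the Ricci terms -/

section Algebra

variable {V W : Type*} [NormedAddCommGroup V] [InnerProductSpace ℝ V]
  [AddCommGroup W] [Module ℝ W]

/-- The vector `⟨v,v⟩ u - ⟨u,v⟩ v` has square `⟨v,v⟩` times the Gram determinant, so a zero
determinant would give a linear relation. -/
lemma gram_ne_zero_of_linearIndependent {u v : V} (h : LinearIndependent ℝ ![u, v]) :
    (inner ℝ u u * inner ℝ v v - inner ℝ u v ^ 2 : ℝ) ≠ 0 := by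
  intro h0
  have hw : inner ℝ v v • u + (-inner ℝ u v) • v = (0 : V) := by
    rw [← inner_self_eq_zero (𝕜 := ℝ)]
    simp only [inner_add_left, inner_add_right, inner_smul_left, inner_smul_right,
      RCLike.conj_to_real, real_inner_comm u v]
    linear_combination inner ℝ v v * h0
  exact h.ne_zero 1 (inner_self_eq_zero.1 (LinearIndependent.pair_iff.1 h _ _ hw).1)

variable [FiniteDimensional ℝ V]

/-- The operator associated with a bilinear form on an inner product space. -/
lemma exists_operator_of_bilin (φ : V →ₗ[ℝ] V →ₗ[ℝ] ℝ) :
    ∃ A : V →ₗ[ℝ] V, ∀ u v, inner ℝ (A u) v = φ u v := by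
  let e := stdOrthonormalBasis ℝ V
  refine ⟨∑ i, (φ.flip (e i)).smulRight (e i), fun u v ↦ ?_⟩
  have h := congrArg (φ u) (e.sum_repr' v)
  simp only [map_sum, map_smul, smul_eq_mul] at h
  rw [← h, LinearMap.sum_apply, sum_inner]
  refine Finset.sum_congr rfl fun i _ ↦ ?_
  simp [inner_smul_left, mul_comm]

/-- The algebraic part of the theorem: a second fundamental form of codimension two which
satisfies the Gauss equation for constant sectional curvature `c ≠ 0` has commuting shape
operators. -/
theorem sum_smul_comm_of_gauss (hV : 3 ≤ Module.finrank ℝ V) {ι : Type*} [Fintype ι]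
    (e : OrthonormalBasis ι ℝ V) (b : W →ₗ[ℝ] W →ₗ[ℝ] ℝ) (hb : ∀ v w, b v w = b w v)
    {N : Submodule ℝ W}
    {η₁ η₂ : W} (h₁₂ : b η₁ η₂ = 0) (h₁ : b η₁ η₁ ≠ 0) (h₂ : b η₂ η₂ ≠ 0)
    (hN : ∀ ν ∈ N, ν = (b η₁ ν / b η₁ η₁) • η₁ + (b η₂ ν / b η₂ η₂) • η₂)
    (II : V →ₗ[ℝ] V →ₗ[ℝ] W) (hII : ∀ u v, II u v ∈ N) (hsymm : ∀ u v, II u v = II v u)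
    {c : ℝ} (hc : c ≠ 0)
    (hG : ∀ u v : V, b (II u u) (II v v) - b (II u v) (II u v) =
      c * (inner ℝ u u * inner ℝ v v - inner ℝ u v ^ 2)) (ξ : W) (u v : V) :
    ∑ i, b ξ (II v (e i)) • II u (e i) = ∑ i, b ξ (II u (e i)) • II v (e i) := by
  obtain ⟨A, hA⟩ := exists_operator_of_bilin (II.compr₂ (b η₁))
  obtain ⟨B, hB⟩ := exists_operator_of_bilin (II.compr₂ (b η₂))
  simp only [LinearMap.compr₂_apply] at hA hB
  have hAs : A.IsSymmetric := fun x y ↦ by rw [hA, real_inner_comm, hA, hsymm]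
  have hBs : B.IsSymmetric := fun x y ↦ by rw [hB, real_inner_comm, hB, hsymm]
  have hdec : ∀ x y, II x y = (inner ℝ (A x) y / b η₁ η₁) • η₁ + (inner ℝ (B x) y / b η₂ η₂) • η₂ :=
    fun x y ↦ by rw [hA, hB]; exact hN _ (hII x y)
  have h₂₁ : b η₂ η₁ = 0 := by rw [hb, h₁₂]
  -- The weights are the inverse squares of `η₁, η₂`; their signs are free, which covers both
  -- signatures.
  have hcomm := commute_of_gauss hV hAs hBs (p := (b η₁ η₁)⁻¹) (q := (b η₂ η₂)⁻¹)
    (inv_ne_zero h₂) hc (by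
      intro x y
      rw [← hG, hdec x x, hdec y y, hdec x y]
      simp only [map_add, map_smul, LinearMap.add_apply, LinearMap.smul_apply, smul_eq_mul, h₁₂,
        h₂₁]
      field_simp
      ring)
  have hsum : ∀ x y : V, ∑ i, inner ℝ x (e i) * inner ℝ y (e i) = inner ℝ x y := fun x y ↦ by
    rw [← e.sum_inner_mul_inner x y]
    exact Finset.sum_congr rfl fun i _ ↦ by rw [real_inner_comm y]
  -- Parseval in the basis `e`: exchanging `x` and `y` affects only the mixed products of `A` and
  -- `B`, and commutation makes these agree.
  have hmain : ∀ x y : V, ∑ i, b ξ (II y (e i)) • II x (e i) =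
      ((b ξ η₁ / b η₁ η₁ * inner ℝ (A y) (A x) + b ξ η₂ / b η₂ η₂ * inner ℝ (B y) (A x))
          / b η₁ η₁) • η₁ +
      ((b ξ η₁ / b η₁ η₁ * inner ℝ (A y) (B x) + b ξ η₂ / b η₂ η₂ * inner ℝ (B y) (B x))
          / b η₂ η₂) • η₂ := by
    intro x y
    rw [← hsum (A y), ← hsum (A y), ← hsum (B y), ← hsum (B y)]
    simp only [Finset.mul_sum, ← Finset.sum_add_distrib, Finset.sum_div, Finset.sum_smul]
    refine Finset.sum_congr rfl fun i _ ↦ ?_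
    rw [hdec y, hdec x]
    simp only [map_add, map_smul, smul_eq_mul]
    module
  rw [hmain, hmain, real_inner_comm (A u) (A v), real_inner_comm (B u) (B v),
    real_inner_comm (A u) (B v), real_inner_comm (A v) (B u), hcomm u v]

end Algebra

/-! ### Normal plane, second fundamental form and conclusion -/

section Main

variable {n : ℕ} {M : Type*} [TopologicalSpace M] [ChartedSpace (EuclideanSpace ℝ (Fin n)) M]
  [RiemannianBundle (fun x : M ↦ TangentSpace (𝓡 n) x)]
  {ε : ℝ} {g : M → EuclideanSpace ℝ (Fin (n + 2))}

lemma ambientCLM_nondegenerate (hε : ε ≠ 0) {v : EuclideanSpace ℝ (Fin (n + 2))}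
    (h : ∀ w, ambientCLM n ε v w = 0) : v = 0 := by
  ext i
  have hi := h (EuclideanSpace.single i 1)
  rw [ambientCLM_apply, ambientForm] at hi
  refine Fin.cases (fun h ↦ ?_) (fun j h ↦ ?_) i hi
  · simpa [hε, Fin.succ_ne_zero] using h
  · simpa [Fin.succ_ne_zero, Pi.single_apply, (Fin.succ_ne_zero _).symm] using h

/-- Rank–nullity for the normal projection, whose kernel is the image of the injective differential:
`(n + 2) - n = 2`. -/
lemma finrank_normalSpace (hg : IsIsometricImmersion ε g) (x : M) :
    Module.finrank ℝ (normalSpace ε g x) = 2 := by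
  have h1 : (normalProj hg x).range = normalSpace ε g x := by
    refine le_antisymm ?_ fun ν hν ↦ ⟨ν, normalPart_eq hg hν (by simp)⟩
    rintro _ ⟨v, rfl⟩
    exact normalProj_mem hg x v
  have h2 : (normalProj hg x).ker = (differential g x).range := by
    refine le_antisymm (fun v hv ↦ ?_) ?_
    · have h := sub_normalPart_mem_range ε g x v
      rwa [← normalProj_apply hg, LinearMap.mem_ker.1 hv, sub_zero] at h
    · rintro _ ⟨u, rfl⟩
      exact normalProj_differential hg x u
  have h3 := (normalProj hg x).finrank_range_add_finrank_ker
  have hinj : Function.Injective (differential g x).toLinearMap := by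
    rw [← LinearMap.ker_eq_bot, LinearMap.ker_eq_bot']
    intro u hu
    have h := hg.isometric x u u
    rw [show differential g x u = 0 from hu] at h
    simpa [ambientForm] using h.symm
  have h4 := LinearMap.finrank_range_of_inj hinj
  have h5 : Module.finrank ℝ (TangentSpace (𝓡 n) x) = n := finrank_euclideanSpace_fin
  rw [h1, h2, finrank_euclideanSpace_fin] at h3
  have h6 : Module.finrank ℝ (differential g x).range = n := h4.trans h5
  omega

/-- The normal space has an orthogonal basis of non-isotropic vectors. -/
lemma exists_orthogonal_basis_normalSpace (hε : ε ≠ 0) (hg : IsIsometricImmersion ε g) (x : M) :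
    ∃ η₁ η₂ : EuclideanSpace ℝ (Fin (n + 2)), ambientCLM n ε η₁ η₂ = 0 ∧
      ambientCLM n ε η₁ η₁ ≠ 0 ∧ ambientCLM n ε η₂ η₂ ≠ 0 ∧
      ∀ ν ∈ normalSpace ε g x, ν = (ambientCLM n ε η₁ ν / ambientCLM n ε η₁ η₁) • η₁ +
        (ambientCLM n ε η₂ ν / ambientCLM n ε η₂ η₂) • η₂ := by
  let B : LinearMap.BilinForm ℝ (normalSpace ε g x) :=
    (ambientCLM n ε).toLinearMap₁₂.domRestrict₁₂ (normalSpace ε g x) (normalSpace ε g x)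
  have hB : ∀ v w, B v w = ambientCLM n ε v w := fun _ _ ↦ rfl
  have hBs : LinearMap.IsSymm B := ⟨fun v w ↦ ambientCLM_comm ε _ _⟩
  -- A normal vector orthogonal to all normal vectors is orthogonal to every `w`, since only the
  -- normal part of `w` contributes; so it is zero.
  have hsep : B.SeparatingLeft := by
    intro ν hν
    refine Subtype.ext (ambientCLM_nondegenerate hε fun w ↦ ?_)
    rw [ambientCLM_comm, ← ambientCLM_normalProj_left hg x ν.2, ambientCLM_comm]
    exact hν ⟨_, normalProj_mem hg x w⟩
  obtain ⟨v', hv'⟩ := LinearMap.BilinForm.exists_orthogonal_basis hBs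
  have hne := hv'.not_isOrtho_basis_self_of_separatingLeft hsep
  obtain ⟨v, hv, hvne⟩ : ∃ v : Module.Basis (Fin 2) ℝ (normalSpace ε g x),
      (∀ i j, i ≠ j → B (v i) (v j) = 0) ∧ ∀ i, B (v i) (v i) ≠ 0 := by
    refine ⟨v'.reindex (finCongr (finrank_normalSpace hg x)), fun i j hij ↦ ?_, fun i ↦ ?_⟩
    · simp only [Module.Basis.reindex_apply]
      exact hv' (by simpa using hij)
    · simp only [Module.Basis.reindex_apply]
      exact hne _
  refine ⟨v 0, v 1, hv 0 1 (by simp), hvne 0, hvne 1, fun ν hν ↦ ?_⟩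
  have hsum := v.sum_repr ⟨ν, hν⟩
  rw [Fin.sum_univ_two] at hsum
  have h0 := congrArg (B (v 0)) hsum
  have h1 := congrArg (B (v 1)) hsum
  rw [map_add, map_smul, map_smul, hv 0 1 (by simp), smul_zero, add_zero, smul_eq_mul] at h0
  rw [map_add, map_smul, map_smul, hv 1 0 (by simp), smul_zero, zero_add, smul_eq_mul] at h1
  have e0 : ambientCLM n ε (v 0) ν / ambientCLM n ε (v 0) (v 0) = v.repr ⟨ν, hν⟩ 0 :=
    (div_eq_iff (hvne 0)).2 h0.symm
  have e1 : ambientCLM n ε (v 1) ν / ambientCLM n ε (v 1) (v 1) = v.repr ⟨ν, hν⟩ 1 :=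
    (div_eq_iff (hvne 1)).2 h1.symm
  rw [e0, e1]
  exact congrArg Subtype.val hsum.symm

/-- The second fundamental form at `x`, expressed in a frame `E` which is orthonormal at `x`. -/
noncomputable def secondFundamentalForm (hg : IsIsometricImmersion ε g)
    (E : Fin n → Π p : M, TangentSpace (𝓡 n) p) (x : M) :
    TangentSpace (𝓡 n) x →ₗ[ℝ] TangentSpace (𝓡 n) x →ₗ[ℝ] EuclideanSpace ℝ (Fin (n + 2)) :=
  LinearMap.mk₂ ℝ
    (fun u v ↦ ∑ i, inner ℝ (E i x) v • normalProj hg x (differential (fieldDeriv (E i) g) x u))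
    (fun u u' v ↦ by simp [Finset.sum_add_distrib])
    (fun a u v ↦ by simp [Finset.smul_sum, smul_comm a])
    (fun u v v' ↦ by simp [inner_add_right, add_smul, Finset.sum_add_distrib])
    (fun a u v ↦ by simp [inner_smul_right, mul_smul, Finset.smul_sum])

/-- The field with constant coefficients in the frame `E` and value `v` at `x`. -/
noncomputable def frameExtension (E : Fin n → Π p : M, TangentSpace (𝓡 n) p) (x : M)
    (v : TangentSpace (𝓡 n) x) (p : M) : TangentSpace (𝓡 n) p :=
  ∑ i, inner ℝ (E i x) v • E i p

variable {E : Fin n → Π p : M, TangentSpace (𝓡 n) p} {x : M}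

lemma frameExtension_self (hE : Orthonormal ℝ fun i ↦ E i x) (v : TangentSpace (𝓡 n) x) :
    frameExtension E x v x = v :=
  sum_inner_smul_of_orthonormal hE v

lemma secondFundamentalForm_mem (hg : IsIsometricImmersion ε g) (u v : TangentSpace (𝓡 n) x) :
    secondFundamentalForm hg E x u v ∈ normalSpace ε g x :=
  Submodule.sum_mem _ fun _ _ ↦ Submodule.smul_mem _ _ (normalProj_mem hg x _)

lemma secondFundamentalForm_frame (hg : IsIsometricImmersion ε g)
    (hE : Orthonormal ℝ fun i ↦ E i x) (u : TangentSpace (𝓡 n) x) (j : Fin n) :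
    secondFundamentalForm hg E x u (E j x) =
      normalProj hg x (differential (fieldDeriv (E j) g) x u) := by
  classical
  simp [secondFundamentalForm, orthonormal_iff_ite.1 hE]

variable [IsManifold (𝓡 n) ∞ M]

lemma smoothFieldAt_frameExtension {p : M} (hE : ∀ i, SmoothFieldAt (E i) p)
    (v : TangentSpace (𝓡 n) x) : SmoothFieldAt (frameExtension E x v) p :=
  SmoothFieldAt.sum_smul _ (fun _ _ ↦ contMDiffAt_const) fun i _ ↦ hE i

/-- The coefficients of the extension are constant, so differentiating produces no extra terms. This
links the pointwise form to the field expressions of the Gauss equation. -/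
lemma normalProj_fieldDeriv_frameExtension (hg : IsIsometricImmersion ε g)
    (hE : ∀ i, SmoothFieldAt (E i) x) (X : Π p : M, TangentSpace (𝓡 n) p)
    (v : TangentSpace (𝓡 n) x) :
    normalProj hg x (fieldDeriv X (fieldDeriv (frameExtension E x v) g) x) =
      secondFundamentalForm hg E x (X x) v := by
  have h1 : fieldDeriv (frameExtension E x v) g =
      fun p ↦ ∑ i, inner ℝ (E i x) v • fieldDeriv (E i) g p := by
    funext p
    simp [fieldDeriv, frameExtension]
  rw [h1, fieldDeriv_sum_smul _ (a := fun i _ ↦ inner ℝ (E i x) v) (fun _ ↦ contMDiffAt_const)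
    fun i ↦ contMDiffAt_fieldDeriv (hE i) (hg.contMDiff x)]
  simp [fieldDeriv, mvfderiv_const, secondFundamentalForm]

/-- The commutator of two derivatives of `g` is the derivative of `g` along a bracket, which is
tangent and projects to zero. -/
lemma secondFundamentalForm_comm (hg : IsIsometricImmersion ε g) (hE : ∀ i, SmoothFieldAt (E i) x)
    (ho : Orthonormal ℝ fun i ↦ E i x) (u v : TangentSpace (𝓡 n) x) :
    secondFundamentalForm hg E x u v = secondFundamentalForm hg E x v u := by
  have h := fieldDeriv_mlieBracket (smoothFieldAt_frameExtension hE u)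
    (smoothFieldAt_frameExtension hE v) (hg.contMDiff x)
  have h1 := congrArg (normalProj hg x) h
  rw [map_sub, normalProj_fieldDeriv_frameExtension hg hE,
    normalProj_fieldDeriv_frameExtension hg hE, frameExtension_self ho,
    frameExtension_self ho] at h1
  refine sub_eq_zero.1 (h1.symm.trans ?_)
  exact normalProj_differential hg x _

variable [IsContMDiffRiemannianBundle (𝓡 n) ∞ (EuclideanSpace ℝ (Fin n))
    (fun x : M ↦ TangentSpace (𝓡 n) x)]

/-- The Gauss equation for constant sectional curvature. -/
lemma secondFundamentalForm_gauss (hg : IsIsometricImmersion ε g) {c : ℝ}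
    (hM : HasConstantSectionalCurvature n M c)
    (hE : ∀ᶠ p in 𝓝 x, (∀ i, SmoothFieldAt (E i) p) ∧ Orthonormal ℝ fun i ↦ E i p)
    (u v : TangentSpace (𝓡 n) x) :
    ambientCLM n ε (secondFundamentalForm hg E x u u) (secondFundamentalForm hg E x v v) -
        ambientCLM n ε (secondFundamentalForm hg E x u v) (secondFundamentalForm hg E x u v) =
      c * (inner ℝ u u * inner ℝ v v - inner ℝ u v ^ 2) := by
  obtain ⟨hs, ho⟩ := hE.self_of_nhds
  by_cases hli : LinearIndependent ℝ ![u, v]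
  · obtain ⟨cov, hcov, hsec⟩ := hM
    have hsm : ∀ w, ∀ᶠ p in 𝓝 x, SmoothFieldAt (frameExtension E x w) p := fun w ↦ by
      filter_upwards [hE] with p hp using smoothFieldAt_frameExtension hp.1 w
    have hK := hsec x (frameExtension E x u) (frameExtension E x v)
      (smoothFieldAt_frameExtension hs u) (smoothFieldAt_frameExtension hs v)
      (by simpa only [frameExtension_self ho] using hli)
    have hgauss := gauss_equation hg hcov (hsm u) (hsm v) (hsm v) (hsm u).self_of_nhds
    simp only [normalProj_fieldDeriv_frameExtension hg hs, frameExtension_self ho] at hgauss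
    rw [sectionalCurvature] at hK
    simp only [frameExtension_self ho] at hK
    have hD := gram_ne_zero_of_linearIndependent hli
    rw [div_eq_iff hD] at hK
    rw [secondFundamentalForm_comm hg hs ho v u] at hgauss
    rw [← hK, hgauss, ambientCLM_comm ε (secondFundamentalForm hg E x v v)]
  -- Sectional curvature says nothing about dependent vectors, but then both sides vanish.
  · have hdep : (∃ a : ℝ, u = a • v) ∨ ∃ a : ℝ, v = a • u := by
      by_contra! h
      refine hli (LinearIndependent.pair_iff.2 fun s t hst ↦ ?_)
      by_contra hne
      by_cases hs0 : s = 0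
      · have ht0 : t ≠ 0 := fun ht ↦ hne ⟨hs0, ht⟩
        refine h.2 0 ?_
        simpa [hs0, ht0] using hst
      · refine h.1 (-t / s) ?_
        rw [div_eq_inv_mul, mul_smul, neg_smul, ← eq_neg_of_add_eq_zero_left hst,
          inv_smul_smul₀ hs0]
    rcases hdep with ⟨a, rfl⟩ | ⟨a, rfl⟩ <;>
    · simp only [map_smul, LinearMap.smul_apply, smul_apply, smul_eq_mul, inner_smul_left,
        inner_smul_right, RCLike.conj_to_real]
      ring

end Main

end FlatNormalBundle

theorem proposition3p3 {n : ℕ} (hn : 3 ≤ n) {M : Type*} [TopologicalSpace M]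
    [ChartedSpace (EuclideanSpace ℝ (Fin n)) M] [IsManifold (𝓡 n) ∞ M]
    [Bundle.RiemannianBundle (fun x : M ↦ TangentSpace (𝓡 n) x)]
    [IsContMDiffRiemannianBundle (𝓡 n) ∞ (EuclideanSpace ℝ (Fin n))
      (fun x : M ↦ TangentSpace (𝓡 n) x)]
    {c : ℝ} (hc : c ≠ 0) (hM : FlatNormalBundle.HasConstantSectionalCurvature n M c)
    {ε : ℝ} (hε : ε = 1 ∨ ε = -1) (g : M → EuclideanSpace ℝ (Fin (n + 2)))
    (hg : FlatNormalBundle.IsIsometricImmersion ε g) :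
    FlatNormalBundle.HasFlatNormalBundle ε g := by
  open FlatNormalBundle in
  intro x X Y ξ hX hY hξ hn'
  have hε0 : ε ≠ 0 := by rcases hε with rfl | rfl <;> norm_num
  obtain ⟨E, hE⟩ := exists_orthonormal_frame (n := n) x
  obtain ⟨hs, ho⟩ := hE.self_of_nhds
  obtain ⟨b, hb⟩ := exists_orthonormalBasis_eq ho
  obtain ⟨η₁, η₂, h₁₂, h₁, h₂, hN⟩ := exists_orthogonal_basis_normalSpace hε0 hg x
  have hdim : 3 ≤ Module.finrank ℝ (TangentSpace (𝓡 n) x) := hn.trans finrank_euclideanSpace_fin.ge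
  have key := sum_smul_comm_of_gauss hdim b (ambientCLM n ε).toLinearMap₁₂ (ambientCLM_comm ε)
    h₁₂ h₁ h₂ hN (secondFundamentalForm hg E x) (secondFundamentalForm_mem hg)
    (secondFundamentalForm_comm hg hs ho) hc (secondFundamentalForm_gauss hg hM hE)
    (ξ x) (X x) (Y x)
  -- On frame vectors the second fundamental form is exactly the expression appearing in the Ricci
  -- equation.
  simp only [hb, secondFundamentalForm_frame hg ho] at key
  rw [ricci_equation hg hE hX hY hξ hn', sub_eq_zero]
  exact key
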